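/- All manifolds are finite-dimensional, real and smooth. A Poisson structure on a manifold $N$ is an antisymmetric bilinear bracket $\{\cdot,\cdot\}$ on $C^\infty(N)$ satisfying the Leibniz rule and the Jacobi identity; a vector field $X$ is Hamiltonian if $Xf=\{\tilde f,f\}$ for some $\tilde f\in C^\infty(N)$ and all $f\in C^\infty(N)$. A system on $N$ is a $t$-dependent vector field $X=(X_t)_{t\in\mathbb R}$, each $X_t$ being a smooth vector field on $N$. A Vessiot–Guldberg (VG) Lie algebra of $X$ is a finite-dimensional Lie algebra of vector fields on $N$ containing every $X_t$. The system $X$ is a Lie–Hamilton system relative to a Poisson structure if the smallest Lie algebra of vector fields containing all the $X_t$ is finite-dimensional and consists of Hamiltonian vector fields. Let $\mathfrak g$ be a finite-dimensional real simple Lie algebra with a basis $e_1,\dots,e_r$, and let $b_1,\dots,b_r:\mathbb R\to\mathbb R$ be arbitrary functions. Equip $\mathfrak g^*$ with the Kirillov–Kostant–Souriau (Lie–Poisson) bracket $$\{f,g\}(\theta)=\langle\theta,[df_\theta,dg_\theta]\rangle ,\qquad df_\theta,dg_\theta\in\mathfrak g^{**}\simeq\mathfrak g,$$ regard $v\in\mathfrak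 g$ as the linear function $\theta\mapsto\langle\theta,v\rangle$ on $\mathfrak g^*$, and let $X_v=\{v,\cdot\}$ be its Hamiltonian vector field. Consider the system on $\mathfrak g^*$, in the coordinates $\theta_\beta=\langle\theta,e_\beta\rangle$, $$\frac{d\theta_\beta}{dt}=\{h(t),e_\beta\}(\theta),\qquad h(t)=\sum_{\alpha=1}^r b_\alpha(t)e_\alpha,\qquad \beta=1,\dots,r, \tag{$*$}$$ that is, the system with $X_t=\sum_\alpha b_\alpha(t)X_{e_\alpha}$. **Theorem.** (1) The system $(*)$ is a Lie–Hamilton system on $\mathfrak g^*$ relative to the Kirillov–Kostant–Souriau bracket; moreover, $\{X_v: v\in\mathfrak g\}$ is a VG Lie algebra of $(*)$ consisting of Hamiltonian vector fields, and $v\mapsto X_v$ is a Lie algebra isomorphism from $\mathfrak g$ onto it. (2) Let $S\subset\mathfrak g^*$ be a symplectic leaf of nonzero dimension (a set of all points that can be joined to a given one by finitely many integral curves of Hamiltonian vector fields, with its structure of connected immersed submanifold whose tangent spaces are spanned by the Hamiltonian vector fields). Then every $X_v$, and hence $(*)$, restricts to $S$; the bracket restricts to a Poisson structure on $S$ that comes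 from a symplectic form; the restriction of $(*)$ is a Lie–Hamilton system on $S$ relative to it; the restrictions $X_v|_S$, $v\in\mathfrak g$, form a VG Lie algebra of this restricted system, consisting of Hamiltonian vector fields, and $v\mapsto X_v|_S$ is a Lie algebra isomorphism from $\mathfrak g$ onto it. -/

import Mathlib

open scoped Manifold ContDiff
open Set

noncomputable section

/-! ### Smooth functions and smooth vector fields on a (boundaryless) smooth manifold -/

/-- The algebra `C^∞(M)` of smooth real functions on a manifold modelled on `E`. -/
abbrev SmoothFn (E : Type*) [NormedAddCommGroup E] [NormedSpace ℝ E]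
    (M : Type*) [TopologicalSpace M] [ChartedSpace E M] : Type _ :=
  C^∞⟮𝓘(ℝ, E), M; 𝓘(ℝ, ℝ), ℝ⟯

/-- Smooth vector fields on `M`: smooth sections of the tangent bundle. -/
abbrev SmoothVF (E : Type*) [NormedAddCommGroup E] [NormedSpace ℝ E]
    (M : Type*) [TopologicalSpace M] [ChartedSpace E M] [IsManifold 𝓘(ℝ, E) ∞ M] : Type _ :=
  Cₛ^∞⟮𝓘(ℝ, E); E, (TangentSpace 𝓘(ℝ, E) : M → Type _)⟯

namespace SmoothVF

theorem two_le_infty : (2 : ℕ∞ω) ≤ ∞ := by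
  have h : ((2 : ℕ∞) : ℕ∞ω) ≤ ((⊤ : ℕ∞) : ℕ∞ω) := WithTop.coe_le_coe.2 le_top
  exact h

theorem three_le_infty : (3 : ℕ∞ω) ≤ ∞ := by
  have h : ((3 : ℕ∞) : ℕ∞ω) ≤ ((⊤ : ℕ∞) : ℕ∞ω) := WithTop.coe_le_coe.2 le_top
  exact h

variable {E : Type*} [NormedAddCommGroup E] [NormedSpace ℝ E]
  {M : Type*} [TopologicalSpace M] [ChartedSpace E M] [IsManifold 𝓘(ℝ, E) ∞ M]

/-- The function `Y f`, the derivative of `f` along the vector field `Y`. -/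
def deriv (Y : SmoothVF E M) (f : SmoothFn E M) (x : M) : ℝ :=
  mfderiv 𝓘(ℝ, E) 𝓘(ℝ, ℝ) f x (Y x)

theorem mdiffAt (Y : SmoothVF E M) (x : M) :
    MDifferentiableAt 𝓘(ℝ, E) (𝓘(ℝ, E).prod 𝓘(ℝ, E))
      (fun y ↦ (⟨y, Y y⟩ : TangentBundle 𝓘(ℝ, E) M)) x :=
  (Y.contMDiff.mdifferentiable (by simp)) x

variable [CompleteSpace E]

/-- The Lie bracket of vector fields. -/
instance : Bracket (SmoothVF E M) (SmoothVF E M) where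
  bracket Y Z :=
    { toFun := VectorField.mlieBracket 𝓘(ℝ, E) Y Z
      contMDiff_toFun := by
        have : IsManifold 𝓘(ℝ, E) (minSmoothness ℝ 3) M :=
          IsManifold.of_le (n := ∞) (by simpa using three_le_infty)
        have : IsManifold 𝓘(ℝ, E) (minSmoothness ℝ 2) M :=
          IsManifold.of_le (n := ∞) (by simpa using two_le_infty)
        have : IsManifold 𝓘(ℝ, E) (((⊤ : ℕ∞) : ℕ∞ω) + 1) M := by
          simpa using (inferInstance : IsManifold 𝓘(ℝ, E) ∞ M)
        exact ContDiff.mlieBracket_vectorField (m := ⊤) (n := ⊤) Y.contMDiff Z.contMDiff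
          (by simp) }

theorem lie_apply (Y Z : SmoothVF E M) (x : M) :
    ⁅Y, Z⁆ x = VectorField.mlieBracket 𝓘(ℝ, E) Y Z x := rfl

instance : LieRing (SmoothVF E M) where
  add_lie Y Z W := by
    have : IsManifold 𝓘(ℝ, E) 2 M := IsManifold.of_le (n := ∞) two_le_infty
    ext x
    exact VectorField.mlieBracket_add_left (Y.mdiffAt x) (Z.mdiffAt x)
  lie_add Y Z W := by
    have : IsManifold 𝓘(ℝ, E) 2 M := IsManifold.of_le (n := ∞) two_le_infty
    ext x
    exact VectorField.mlieBracket_add_right (Z.mdiffAt x) (W.mdiffAt x)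
  lie_self Y := by
    ext x
    simp [lie_apply]
  leibniz_lie Y Z W := by
    have : IsManifold 𝓘(ℝ, E) (minSmoothness ℝ 3) M :=
      IsManifold.of_le (n := ∞) (by simpa using three_le_infty)
    have h (U : SmoothVF E M) : ContMDiff 𝓘(ℝ, E) (𝓘(ℝ, E).prod 𝓘(ℝ, E)) (minSmoothness ℝ 2)
        (fun y ↦ (⟨y, U y⟩ : TangentBundle 𝓘(ℝ, E) M)) :=
      U.contMDiff.of_le (by simpa using two_le_infty)
    ext x
    exact VectorField.leibniz_identity_mlieBracket_apply (h Y x) (h Z x) (h W x)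

instance : LieAlgebra ℝ (SmoothVF E M) where
  lie_smul c Y Z := by
    have : IsManifold 𝓘(ℝ, E) 2 M := IsManifold.of_le (n := ∞) two_le_infty
    ext x
    exact VectorField.mlieBracket_const_smul_right (Z.mdiffAt x)

end SmoothVF

/-! ### Poisson structures and Lie–Hamilton systems -/

/-- A Poisson structure on `M`. -/
structure PoissonStructure (E : Type*) [NormedAddCommGroup E] [NormedSpace ℝ E]
    (M : Type*) [TopologicalSpace M] [ChartedSpace E M] where
  /-- the Poisson bracket `{f, g}` -/
  bracket : SmoothFn E M →ₗ[ℝ] SmoothFn E M →ₗ[ℝ] SmoothFn E M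
  skew : ∀ f g, bracket f g = -bracket g f
  leibniz : ∀ f g h, bracket f (g * h) = bracket f g * h + g * bracket f h
  jacobi : ∀ f g h,
    bracket f (bracket g h) + bracket g (bracket h f) + bracket h (bracket f g) = 0

namespace PoissonStructure

variable {E : Type*} [NormedAddCommGroup E] [NormedSpace ℝ E]
  {M : Type*} [TopologicalSpace M] [ChartedSpace E M]

/-- The Poisson structure comes from a symplectic form: the map `T*M → TM` given by the Poisson
bivector is injective (hence, in finite dimension, an isomorphism) at every point. -/
def IsSymplectic (P : PoissonStructure E M) : Prop :=
  ∀ (x : M) (f : SmoothFn E M), (∀ g, P.bracket f g x = 0) →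
    mfderiv 𝓘(ℝ, E) 𝓘(ℝ, ℝ) f x = 0

variable [IsManifold 𝓘(ℝ, E) ∞ M]

/-- `Y` is the Hamiltonian vector field of `f`: `Y g = {f, g}` for all `g`. -/
def IsHamiltonianFieldOf (P : PoissonStructure E M) (f : SmoothFn E M) (Y : SmoothVF E M) :
    Prop :=
  ∀ (g : SmoothFn E M) (x : M), Y.deriv g x = P.bracket f g x

/-- `Y` is a Hamiltonian vector field. -/
def IsHamiltonianField (P : PoissonStructure E M) (Y : SmoothVF E M) : Prop :=
  ∃ f, P.IsHamiltonianFieldOf f Y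

/-- The subspace of `T_x M` spanned by the values at `x` of the Hamiltonian vector fields. -/
def characteristicSpace (P : PoissonStructure E M) (x : M) :
    Submodule ℝ (TangentSpace 𝓘(ℝ, E) x) :=
  Submodule.span ℝ {v | ∃ Y : SmoothVF E M, P.IsHamiltonianField Y ∧ Y x = v}

/-- The points `x` and `y` are the endpoints of an integral curve of a Hamiltonian vector field. -/
def HamiltonianStep (P : PoissonStructure E M) (x y : M) : Prop :=
  ∃ (Y : SmoothVF E M) (γ : ℝ → M), P.IsHamiltonianField Y ∧
    IsMIntegralCurveOn γ (fun z ↦ Y z) (Icc (0 : ℝ) 1) ∧ γ 0 = x ∧ γ 1 = y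

/-- The set of points that can be reached from `x` along finite concatenations of integral curves
of Hamiltonian vector fields. -/
def leafThrough (P : PoissonStructure E M) (x : M) : Set M :=
  {y | Relation.ReflTransGen P.HamiltonianStep x y}

/-- A symplectic leaf of the Poisson manifold `(M, P)`, as an injectively immersed connected
manifold `j : S → M` whose tangent spaces are spanned by the Hamiltonian vector fields and whose
image is a full class of points connected by Hamiltonian curves. -/
structure IsSymplecticLeaf (P : PoissonStructure E M)
    (F : Type*) [NormedAddCommGroup F] [NormedSpace ℝ F]
    {S : Type*} [TopologicalSpace S] [ChartedSpace F S] (j : S → M) : Prop where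
  connected : ConnectedSpace S
  injective : Function.Injective j
  immersion : Manifold.IsImmersion 𝓘(ℝ, F) 𝓘(ℝ, E) ∞ j
  tangent : ∀ s : S,
    (mfderiv 𝓘(ℝ, F) 𝓘(ℝ, E) j s).range = P.characteristicSpace (j s)
  range_eq : ∀ s : S, range j = P.leafThrough (j s)

/-- `Q` is the restriction of the Poisson structure `P` to `S` along `j : S → M`, i.e. the Poisson
bivectors are `j`-related. -/
def IsRestriction (P : PoissonStructure E M)
    {F : Type*} [NormedAddCommGroup F] [NormedSpace ℝ F]
    {S : Type*} [TopologicalSpace S] [ChartedSpace F S] (j : S → M)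
    (Q : PoissonStructure F S) : Prop :=
  ∀ (f g : SmoothFn E M) (f' g' : SmoothFn F S), (∀ s, f' s = f (j s)) → (∀ s, g' s = g (j s)) →
    ∀ s, Q.bracket f' g' s = P.bracket f g (j s)

end PoissonStructure

/-- `Z` is the restriction of the vector field `Y` to `S` along `j : S → M`:
`dj (Z s) = Y (j s)` for all `s`. -/
def SmoothVF.IsRestriction {E : Type*} [NormedAddCommGroup E] [NormedSpace ℝ E]
    {M : Type*} [TopologicalSpace M] [ChartedSpace E M] [IsManifold 𝓘(ℝ, E) ∞ M]
    {F : Type*} [NormedAddCommGroup F] [NormedSpace ℝ F]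
    {S : Type*} [TopologicalSpace S] [ChartedSpace F S] [IsManifold 𝓘(ℝ, F) ∞ S]
    (Y : SmoothVF E M) (j : S → M) (Z : SmoothVF F S) : Prop :=
  ∀ s : S, mfderiv 𝓘(ℝ, F) 𝓘(ℝ, E) j s (Z s) = Y (j s)

section Systems

variable {E : Type*} [NormedAddCommGroup E] [NormedSpace ℝ E] [CompleteSpace E]
  {M : Type*} [TopologicalSpace M] [ChartedSpace E M] [IsManifold 𝓘(ℝ, E) ∞ M]

/-- The smallest Lie algebra of vector fields containing all the `X t`. -/
def minimalLieAlgebra (X : ℝ → SmoothVF E M) : LieSubalgebra ℝ (SmoothVF E M) :=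
  LieSubalgebra.lieSpan ℝ (SmoothVF E M) (range X)

/-- `V` is a Vessiot–Guldberg Lie algebra of the system `X`: a finite-dimensional Lie algebra of
vector fields such that `X t ∈ V` for every `t`. -/
def IsVessiotGuldberg (V : LieSubalgebra ℝ (SmoothVF E M)) (X : ℝ → SmoothVF E M) : Prop :=
  FiniteDimensional ℝ V ∧ ∀ t, X t ∈ V

/-- `X` is a Lie–Hamilton system relative to the Poisson structure `P`: its smallest Lie algebra is
a finite-dimensional Lie algebra of Hamiltonian vector fields. -/
def PoissonStructure.IsLieHamiltonSystem (P : PoissonStructure E M) (X : ℝ → SmoothVF E M) :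
    Prop :=
  FiniteDimensional ℝ (minimalLieAlgebra X) ∧ ∀ Y ∈ minimalLieAlgebra X, P.IsHamiltonianField Y

end Systems

/-! ### The dual of a finite-dimensional Lie algebra and the Kirillov–Kostant–Souriau bracket -/

/-- The dual space `𝔤*`. -/
def LieDual (𝔤 : Type*) [LieRing 𝔤] [LieAlgebra ℝ 𝔤] : Type _ := Module.Dual ℝ 𝔤

namespace LieDual

variable (𝔤 : Type*) [LieRing 𝔤] [LieAlgebra ℝ 𝔤]

instance : AddCommGroup (LieDual 𝔤) := inferInstanceAs (AddCommGroup (Module.Dual ℝ 𝔤))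

instance : Module ℝ (LieDual 𝔤) := inferInstanceAs (Module ℝ (Module.Dual ℝ 𝔤))

/-- The tautological identification of `LieDual 𝔤` with the algebraic dual. -/
def toDual : LieDual 𝔤 ≃ₗ[ℝ] Module.Dual ℝ 𝔤 := LinearEquiv.refl ℝ _

variable {𝔤}

/-- The pairing `⟨θ, v⟩`. -/
def pair (θ : LieDual 𝔤) (v : 𝔤) : ℝ := toDual 𝔤 θ v

/-- The element `⟨θ, [v, ·]⟩` of `𝔤*`. -/
def flowVec (v : 𝔤) (θ : LieDual 𝔤) : LieDual 𝔤 :=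
  (toDual 𝔤).symm ((toDual 𝔤 θ) ∘ₗ (LieAlgebra.ad ℝ 𝔤 v))

theorem pair_flowVec (v w : 𝔤) (θ : LieDual 𝔤) : pair (flowVec v θ) w = pair θ ⁅v, w⁆ := rfl

variable (𝔤) [FiniteDimensional ℝ 𝔤]

instance : FiniteDimensional ℝ (LieDual 𝔤) :=
  inferInstanceAs (FiniteDimensional ℝ (Module.Dual ℝ 𝔤))

/-- Coordinates on `𝔤*` given by some basis of `𝔤`, used only to choose a norm. -/
def coords : LieDual 𝔤 →ₗ[ℝ] (Fin (Module.finrank ℝ 𝔤) → ℝ) where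
  toFun θ i := toDual 𝔤 θ (Module.finBasis ℝ 𝔤 i)
  map_add' _ _ := rfl
  map_smul' _ _ := rfl

theorem coords_injective : Function.Injective (coords 𝔤) := fun _ _ h ↦
  (toDual 𝔤).injective ((Module.finBasis ℝ 𝔤).ext fun i ↦ congrFun h i)

/-- A norm on the finite-dimensional space `𝔤*`. All norms define the same smooth structure. -/
instance : NormedAddCommGroup (LieDual 𝔤) :=
  NormedAddCommGroup.induced (LieDual 𝔤) (Fin (Module.finrank ℝ 𝔤) → ℝ) (coords 𝔤)
    (coords_injective 𝔤)

instance : NormedSpace ℝ (LieDual 𝔤) := NormedSpace.induced ℝ (LieDual 𝔤) _ (coords 𝔤)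

instance : CompleteSpace (LieDual 𝔤) := FiniteDimensional.complete ℝ _

variable {𝔤}

/-- The canonical isomorphism `𝔤** ≃ 𝔤`. -/
def bidual : (LieDual 𝔤 →L[ℝ] ℝ) →ₗ[ℝ] 𝔤 where
  toFun α := (Module.evalEquiv ℝ 𝔤).symm (α.toLinearMap ∘ₗ (toDual 𝔤).symm.toLinearMap)
  map_add' α β := by rw [← map_add]; rfl
  map_smul' c α := by rw [RingHom.id_apply, ← map_smul]; rfl

theorem pair_bidual (θ : LieDual 𝔤) (α : LieDual 𝔤 →L[ℝ] ℝ) : pair θ (bidual α) = α θ := by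
  have h := Module.apply_evalEquiv_symm_apply (R := ℝ) (M := 𝔤) (toDual 𝔤 θ)
    (α.toLinearMap ∘ₗ (toDual 𝔤).symm.toLinearMap)
  exact h

/-- The differential `df_θ`, regarded as an element of `𝔤`. -/
def diff (f : SmoothFn (LieDual 𝔤) (LieDual 𝔤)) (θ : LieDual 𝔤) : 𝔤 := bidual (fderiv ℝ f θ)

theorem contDiff_coe (f : SmoothFn (LieDual 𝔤) (LieDual 𝔤)) : ContDiff ℝ ∞ f :=
  f.contMDiff.contDiff

/-- `(α, β, θ) ↦ ⟨θ, [α, β]⟩`, as a continuous trilinear map. -/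
def form : (LieDual 𝔤 →L[ℝ] ℝ) →L[ℝ] (LieDual 𝔤 →L[ℝ] ℝ) →L[ℝ] LieDual 𝔤 →L[ℝ] ℝ :=
  LinearMap.toContinuousBilinearMap <|
    LinearMap.mk₂ ℝ
      (fun α β ↦ LinearMap.toContinuousLinearMap
        { toFun := fun θ : LieDual 𝔤 ↦ pair θ ⁅bidual α, bidual β⁆
          map_add' := fun _ _ ↦ rfl
          map_smul' := fun _ _ ↦ rfl })
      (fun α α' β ↦ by ext θ; simp [pair])
      (fun c α β ↦ by ext θ; simp [pair])
      (fun α β β' ↦ by ext θ; simp [pair])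
      (fun c α β ↦ by ext θ; simp [pair])

theorem form_apply (α β : LieDual 𝔤 →L[ℝ] ℝ) (θ : LieDual 𝔤) :
    form α β θ = pair θ ⁅bidual α, bidual β⁆ := rfl

theorem contDiff_bracket (f g : SmoothFn (LieDual 𝔤) (LieDual 𝔤)) :
    ContDiff ℝ ∞ fun θ ↦ pair θ ⁅diff f θ, diff g θ⁆ := by
  have hf : ContDiff ℝ ∞ (fderiv ℝ f) := (contDiff_coe f).fderiv_right (by simp)
  have hg : ContDiff ℝ ∞ (fderiv ℝ g) := (contDiff_coe g).fderiv_right (by simp)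
  change ContDiff ℝ ∞ fun θ ↦ form (fderiv ℝ f θ) (fderiv ℝ g θ) θ
  fun_prop

/-- The bracket `{f, g}(θ) = ⟨θ, [df_θ, dg_θ]⟩`. -/
def bracketFn (f g : SmoothFn (LieDual 𝔤) (LieDual 𝔤)) : SmoothFn (LieDual 𝔤) (LieDual 𝔤) :=
  ⟨fun θ ↦ pair θ ⁅diff f θ, diff g θ⁆, (contDiff_bracket f g).contMDiff⟩

theorem bracketFn_apply (f g : SmoothFn (LieDual 𝔤) (LieDual 𝔤)) (θ : LieDual 𝔤) :
    bracketFn f g θ = pair θ ⁅diff f θ, diff g θ⁆ := rfl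

theorem differentiable_coe (f : SmoothFn (LieDual 𝔤) (LieDual 𝔤)) (θ : LieDual 𝔤) :
    DifferentiableAt ℝ f θ := (contDiff_coe f).differentiable (by simp) θ

theorem diff_add (f g : SmoothFn (LieDual 𝔤) (LieDual 𝔤)) (θ : LieDual 𝔤) :
    diff (f + g) θ = diff f θ + diff g θ := by
  have h : fderiv ℝ (⇑(f + g)) θ = fderiv ℝ f θ + fderiv ℝ g θ :=
    fderiv_add (differentiable_coe f θ) (differentiable_coe g θ)
  rw [diff, h, map_add, diff, diff]

theorem diff_smul (c : ℝ) (f : SmoothFn (LieDual 𝔤) (LieDual 𝔤)) (θ : LieDual 𝔤) :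
    diff (c • f) θ = c • diff f θ := by
  have h : fderiv ℝ (⇑(c • f)) θ = c • fderiv ℝ f θ :=
    fderiv_const_smul (differentiable_coe f θ) c
  rw [diff, h, map_smul, diff]

theorem diff_mul (f g : SmoothFn (LieDual 𝔤) (LieDual 𝔤)) (θ : LieDual 𝔤) :
    diff (f * g) θ = f θ • diff g θ + g θ • diff f θ := by
  have h : fderiv ℝ (⇑(f * g)) θ = f θ • fderiv ℝ g θ + g θ • fderiv ℝ f θ :=
    fderiv_mul (differentiable_coe f θ) (differentiable_coe g θ)
  rw [diff, h, map_add, map_smul, map_smul, diff, diff]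

theorem form_left (α : LieDual 𝔤 →L[ℝ] ℝ) (g : SmoothFn (LieDual 𝔤) (LieDual 𝔤)) (θ : LieDual 𝔤) :
    form α (fderiv ℝ g θ) θ = -α (flowVec (diff g θ) θ) := by
  rw [form_apply, ← pair_bidual, pair_flowVec, ← lie_skew, diff]
  exact map_neg (toDual 𝔤 θ) _

theorem form_right (f : SmoothFn (LieDual 𝔤) (LieDual 𝔤)) (β : LieDual 𝔤 →L[ℝ] ℝ) (θ : LieDual 𝔤) :
    form (fderiv ℝ f θ) β θ = β (flowVec (diff f θ) θ) := by
  rw [form_apply, ← pair_bidual, pair_flowVec, diff]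

theorem pair_lie_diff (f g : SmoothFn (LieDual 𝔤) (LieDual 𝔤)) (θ : LieDual 𝔤) :
    pair θ ⁅diff f θ, diff g θ⁆ = fderiv ℝ g θ (flowVec (diff f θ) θ) :=
  form_right f (fderiv ℝ g θ) θ

set_option maxSynthPendingDepth 3 in
theorem fderiv_bracketFn (f g : SmoothFn (LieDual 𝔤) (LieDual 𝔤)) (θ η : LieDual 𝔤) :
    fderiv ℝ (bracketFn f g) θ η = pair η ⁅diff f θ, diff g θ⁆
      - fderiv ℝ (fderiv ℝ f) θ η (flowVec (diff g θ) θ)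
      + fderiv ℝ (fderiv ℝ g) θ η (flowVec (diff f θ) θ) := by
  have hf : HasFDerivAt (fderiv ℝ f) (fderiv ℝ (fderiv ℝ f) θ) θ :=
    (((contDiff_coe f).fderiv_right (m := ∞) (by simp)).differentiable (by simp) θ).hasFDerivAt
  have hg : HasFDerivAt (fderiv ℝ g) (fderiv ℝ (fderiv ℝ g) θ) θ :=
    (((contDiff_coe g).fderiv_right (m := ∞) (by simp)).differentiable (by simp) θ).hasFDerivAt
  have h₁ : HasFDerivAt (fun ζ ↦ form (𝔤 := 𝔤) (fderiv ℝ f ζ)) _ θ :=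
    (form (𝔤 := 𝔤)).hasFDerivAt.comp θ hf
  have h₂ : HasFDerivAt (fun ζ ↦ form (𝔤 := 𝔤) (fderiv ℝ f ζ) (fderiv ℝ g ζ)) _ θ :=
    h₁.clm_apply hg
  have h' : HasFDerivAt (bracketFn f g) _ θ := h₂.clm_apply (hasFDerivAt_id θ)
  rw [h'.fderiv]
  simp [form_left, form_right]
  rw [form_apply]
  simp only [diff]
  ring

end LieDual

open LieDual in
/-- The Kirillov–Kostant–Souriau (Lie–Poisson) structure on `𝔤*`. -/
def kks (𝔤 : Type*) [LieRing 𝔤] [LieAlgebra ℝ 𝔤] [FiniteDimensional ℝ 𝔤] :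
    PoissonStructure (LieDual 𝔤) (LieDual 𝔤) where
  bracket := LinearMap.mk₂ ℝ bracketFn
    (fun f f' g ↦ by ext θ; simp [bracketFn_apply, diff_add, pair])
    (fun c f g ↦ by ext θ; simp [bracketFn_apply, diff_smul, pair])
    (fun f g g' ↦ by ext θ; simp [bracketFn_apply, diff_add, pair])
    (fun c f g ↦ by ext θ; simp [bracketFn_apply, diff_smul, pair])
  skew f g := by
    ext θ
    simp only [LinearMap.mk₂_apply, ContMDiffMap.coe_neg, Pi.neg_apply, bracketFn_apply]
    rw [← lie_skew]
    exact map_neg (toDual 𝔤 θ) _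
  leibniz f g h := by
    ext θ
    simp [bracketFn_apply, diff_mul, pair]
    ring
  jacobi f g h := by
    ext θ
    have key (f g h : SmoothFn (LieDual 𝔤) (LieDual 𝔤)) :
        bracketFn f (bracketFn g h) θ = pair θ ⁅diff f θ, ⁅diff g θ, diff h θ⁆⁆
          - fderiv ℝ (fderiv ℝ g) θ (flowVec (diff f θ) θ) (flowVec (diff h θ) θ)
          + fderiv ℝ (fderiv ℝ h) θ (flowVec (diff f θ) θ) (flowVec (diff g θ) θ) := by
      rw [bracketFn_apply, pair_lie_diff, fderiv_bracketFn, pair_flowVec]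
    have sym (f : SmoothFn (LieDual 𝔤) (LieDual 𝔤)) (η ξ : LieDual 𝔤) :
        fderiv ℝ (fderiv ℝ f) θ η ξ = fderiv ℝ (fderiv ℝ f) θ ξ η :=
      ((contDiff_coe f).contDiffAt.isSymmSndFDerivAt (by simpa using SmoothVF.two_le_infty)) η ξ
    have jac : pair θ ⁅diff f θ, ⁅diff g θ, diff h θ⁆⁆ + pair θ ⁅diff g θ, ⁅diff h θ, diff f θ⁆⁆
        + pair θ ⁅diff h θ, ⁅diff f θ, diff g θ⁆⁆ = 0 := by
      simp only [pair, ← map_add, lie_jacobi, map_zero]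
    change bracketFn f (bracketFn g h) θ + bracketFn g (bracketFn h f) θ
      + bracketFn h (bracketFn f g) θ = 0
    rw [key, key, key, sym f (flowVec (diff g θ) θ), sym g (flowVec (diff f θ) θ),
      sym h (flowVec (diff f θ) θ)]
    linarith

namespace LieDual

variable {𝔤 : Type*} [LieRing 𝔤] [LieAlgebra ℝ 𝔤] [FiniteDimensional ℝ 𝔤]

theorem kks_apply (f g : SmoothFn (LieDual 𝔤) (LieDual 𝔤)) (θ : LieDual 𝔤) :
    (kks 𝔤).bracket f g θ = pair θ ⁅diff f θ, diff g θ⁆ := rfl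

/-- The linear function `θ ↦ ⟨θ, v⟩` on `𝔤*`, for `v ∈ 𝔤`, as a continuous linear map. -/
def evalCLM (v : 𝔤) : LieDual 𝔤 →L[ℝ] ℝ :=
  LinearMap.toContinuousLinearMap
    { toFun := fun θ : LieDual 𝔤 ↦ pair θ v
      map_add' := fun _ _ ↦ rfl
      map_smul' := fun _ _ ↦ rfl }

/-- An element `v ∈ 𝔤 ≃ 𝔤**` regarded as the smooth function `θ ↦ ⟨θ, v⟩` on `𝔤*`. -/
def linFn : 𝔤 →ₗ[ℝ] SmoothFn (LieDual 𝔤) (LieDual 𝔤) where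
  toFun v := ⟨fun θ ↦ pair θ v, (evalCLM v).contDiff.contMDiff⟩
  map_add' v w := by ext θ; exact map_add (toDual 𝔤 θ) v w
  map_smul' c v := by ext θ; exact map_smul (toDual 𝔤 θ) c v

theorem linFn_apply (v : 𝔤) (θ : LieDual 𝔤) : linFn v θ = pair θ v := rfl

theorem diff_linFn (v : 𝔤) (θ : LieDual 𝔤) : diff (linFn v) θ = v := by
  have h : fderiv ℝ (linFn v) θ = evalCLM v := (evalCLM v).fderiv
  rw [diff, h]
  exact (Module.evalEquiv ℝ 𝔤).symm_apply_apply v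

/-- The element `w ↦ {v, w}(θ)` of `𝔤*`. -/
def kksVec (v : 𝔤) (θ : LieDual 𝔤) : LieDual 𝔤 :=
  (toDual 𝔤).symm
    { toFun := fun w ↦ (kks 𝔤).bracket (linFn v) (linFn w) θ
      map_add' := fun w w' ↦ by simp
      map_smul' := fun c w ↦ by simp }

theorem pair_kksVec (v w : 𝔤) (θ : LieDual 𝔤) :
    pair (kksVec v θ) w = (kks 𝔤).bracket (linFn v) (linFn w) θ := rfl

theorem kksVec_eq (v : 𝔤) (θ : LieDual 𝔤) : kksVec v θ = flowVec v θ := by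
  refine LinearMap.ext fun w ↦ ?_
  change (kks 𝔤).bracket (linFn v) (linFn w) θ = pair θ ⁅v, w⁆
  rw [kks_apply, diff_linFn, diff_linFn]

theorem contDiff_kksVec (v : 𝔤) : ContDiff ℝ ∞ (kksVec v) := by
  let L : LieDual 𝔤 →ₗ[ℝ] LieDual 𝔤 :=
    { toFun := flowVec v
      map_add' := fun _ _ ↦ rfl
      map_smul' := fun _ _ ↦ rfl }
  have h : kksVec v = LinearMap.toContinuousLinearMap L := funext (kksVec_eq v)
  rw [h]
  exact ContinuousLinearMap.contDiff _

/-- The vector field `X_v = {v, ·}` on `𝔤*`: its value at `θ` is the element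
`w ↦ {v, w}(θ)` of `T_θ 𝔤* ≃ 𝔤*`. -/
def kksField (v : 𝔤) : SmoothVF (LieDual 𝔤) (LieDual 𝔤) where
  toFun θ := kksVec v θ
  contMDiff_toFun := contMDiff_vectorSpace_iff_contDiff.2 (contDiff_kksVec v)

/-- The system on `𝔤*` given in the coordinates `θ_β = ⟨θ, e_β⟩` by `dθ_β/dt = {h(t), e_β}`,
where `h(t) = ∑ b_α(t) e_α`, identified with its time-dependent vector field. -/
def kksSystem {ι : Type*} [Fintype ι] (e : Module.Basis ι ℝ 𝔤) (b : ι → ℝ → ℝ) (t : ℝ) :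
    SmoothVF (LieDual 𝔤) (LieDual 𝔤) :=
  kksField (∑ α, b α t • e α)

theorem kksSystem_coord {ι : Type*} [Fintype ι] (e : Module.Basis ι ℝ 𝔤) (b : ι → ℝ → ℝ) (t : ℝ)
    (θ : LieDual 𝔤) (β : ι) :
    pair (kksSystem e b t θ) (e β) =
      (kks 𝔤).bracket (linFn (∑ α, b α t • e α)) (linFn (e β)) θ := rfl

end LieDual
end

/-! The field $X_v$ is the linear field $\theta\mapsto\langle\theta,[v,\cdot]\rangle$ on $\mathfrak
g^*$, so $[X_v,X_w]=X_{[v,w]}$ is the Jacobi identity of $\mathfrak g$ (`flowVec_lie`). For an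
immersion $j$ tangent to these fields, the same holds for their restrictions: the bracket of two
restrictions is tested on $j$ itself as a vector-valued function (`mfderiv_lie_apply`,
`isRestriction_lie`), and $dj$ is injective. The space $\mathfrak g^*$ is the case $j=\mathrm{id}$.
Thus $v\mapsto X_v|_S$ is a Lie algebra homomorphism whose kernel is an ideal. By simplicity it is
injective unless it vanishes, which is excluded on $\mathfrak g^*$ by noncommutativity and on a leaf
by its nonzero dimension.

The Poisson structure on a leaf is built pointwise. Smooth functions on $S$ extend locally to
$\mathfrak g^*$, so $df_s$ is the restriction of some $v\in\mathfrak g$ to $T_sS$. Since $T_sS$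
consists of the values of the $X_w$, the number $\langle j(s),[v,w]\rangle$ depends only on the two
differentials represented by $v$ and $w$ (`Represents.pair_lie_eq`). Smoothness and the Jacobi
identity come from local extensions (`eventually_pair_leafDiff`), and nondegeneracy holds because
the $X_w$ span $T_sS$. -/

open scoped Manifold ContDiff Topology
open Set VectorField

noncomputable section

/-! ### The Lie bracket as a commutator of derivations -/

section LieBracketDerivation

variable {E : Type*} [NormedAddCommGroup E] [NormedSpace ℝ E]
  {M : Type*} [TopologicalSpace M] [ChartedSpace E M] [IsManifold 𝓘(ℝ, E) ∞ M]
  {G : Type*} [NormedAddCommGroup G] [NormedSpace ℝ G]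

theorem mfderiv_extChartAt_symm_isInvertible (x : M) {z : E}
    (hz : z ∈ (extChartAt 𝓘(ℝ, E) x).target) :
    (mfderiv 𝓘(ℝ, E) 𝓘(ℝ, E) (extChartAt 𝓘(ℝ, E) x).symm z).IsInvertible := by
  have : IsManifold 𝓘(ℝ, E) 1 M := IsManifold.of_le (n := ∞) (by simp)
  have h := isInvertible_mfderivWithin_extChartAt_symm hz
  rwa [ModelWithCorners.range_eq_univ, mfderivWithin_univ] at h

theorem mdifferentiableAt_extChartAt_symm (x : M) {z : E}
    (hz : z ∈ (extChartAt 𝓘(ℝ, E) x).target) :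
    MDifferentiableAt 𝓘(ℝ, E) 𝓘(ℝ, E) (extChartAt 𝓘(ℝ, E) x).symm z := by
  have : IsManifold 𝓘(ℝ, E) 1 M := IsManifold.of_le (n := ∞) (by simp)
  have h := mdifferentiableWithinAt_extChartAt_symm hz
  rwa [ModelWithCorners.range_eq_univ, mdifferentiableWithinAt_univ] at h

/-- The representative of a vector field in the chart at `x`. -/
def chartField (x : M) (Y : SmoothVF E M) (z : E) : E :=
  mpullback 𝓘(ℝ, E) 𝓘(ℝ, E) (extChartAt 𝓘(ℝ, E) x).symm (fun y ↦ Y y) z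

theorem fderiv_comp_extChartAt_symm_chartField {h : M → G} (x : M) (Y : SmoothVF E M) {z : E}
    (hz : z ∈ (extChartAt 𝓘(ℝ, E) x).target)
    (hh : MDifferentiableAt 𝓘(ℝ, E) 𝓘(ℝ, G) h ((extChartAt 𝓘(ℝ, E) x).symm z)) :
    fderiv ℝ (h ∘ (extChartAt 𝓘(ℝ, E) x).symm) z (chartField x Y z) =
      mfderiv 𝓘(ℝ, E) 𝓘(ℝ, G) h ((extChartAt 𝓘(ℝ, E) x).symm z)
        (Y ((extChartAt 𝓘(ℝ, E) x).symm z)) := by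
  rw [← mfderiv_eq_fderiv, mfderiv_comp z hh (mdifferentiableAt_extChartAt_symm x hz)]
  have h1 : mfderiv 𝓘(ℝ, E) 𝓘(ℝ, E) (extChartAt 𝓘(ℝ, E) x).symm z (chartField x Y z : E) =
      Y ((extChartAt 𝓘(ℝ, E) x).symm z) :=
    (mfderiv_extChartAt_symm_isInvertible x hz).self_apply_inverse _
  exact congrArg (mfderiv 𝓘(ℝ, E) 𝓘(ℝ, G) h ((extChartAt 𝓘(ℝ, E) x).symm z)) h1

/-- Near $x$, $f$ factors through the chart. The manifold bracket is the chart bracket transported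
by this inverse, so the lemma reduces its action on $f$ to a Euclidean derivative. -/
theorem mfderiv_comp_extChartAt_inverse {f : M → G} (x : M)
    (hf : MDifferentiableAt 𝓘(ℝ, E) 𝓘(ℝ, G) f x) (u : E) :
    mfderiv 𝓘(ℝ, E) 𝓘(ℝ, G) f x
      ((mfderiv 𝓘(ℝ, E) 𝓘(ℝ, E) (extChartAt 𝓘(ℝ, E) x) x).inverse u) =
      fderiv ℝ (f ∘ (extChartAt 𝓘(ℝ, E) x).symm) (extChartAt 𝓘(ℝ, E) x x) u := by
  have : IsManifold 𝓘(ℝ, E) 1 M := IsManifold.of_le (n := ∞) (by simp)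
  have hz := mem_extChartAt_target (I := 𝓘(ℝ, E)) x
  have hx := mem_extChartAt_source (I := 𝓘(ℝ, E)) x
  have e1 : f =ᶠ[𝓝 x] (f ∘ (extChartAt 𝓘(ℝ, E) x).symm) ∘ extChartAt 𝓘(ℝ, E) x := by
    filter_upwards [extChartAt_source_mem_nhds (I := 𝓘(ℝ, E)) x] with y hy
    exact congrArg f ((extChartAt 𝓘(ℝ, E) x).left_inv hy).symm
  have hg : MDifferentiableAt 𝓘(ℝ, E) 𝓘(ℝ, G) (f ∘ (extChartAt 𝓘(ℝ, E) x).symm)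
      (extChartAt 𝓘(ℝ, E) x x) := by
    refine MDifferentiableAt.comp _ ?_ (mdifferentiableAt_extChartAt_symm x hz)
    rwa [extChartAt_to_inv]
  rw [e1.mfderiv_eq, mfderiv_comp x hg (mdifferentiableAt_extChartAt (by simp)),
    mfderiv_eq_fderiv]
  exact congrArg (fderiv ℝ (f ∘ (extChartAt 𝓘(ℝ, E) x).symm) (extChartAt 𝓘(ℝ, E) x x))
    ((isInvertible_mfderiv_extChartAt hx).self_apply_inverse u)

variable [CompleteSpace E]

theorem differentiableAt_chartField (x : M) (Y : SmoothVF E M) :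
    DifferentiableAt ℝ (chartField x Y) (extChartAt 𝓘(ℝ, E) x x) := by
  have : IsManifold 𝓘(ℝ, E) 2 M := IsManifold.of_le (n := ∞) SmoothVF.two_le_infty
  have h := MDifferentiableWithinAt.differentiableWithinAt_mpullbackWithin_vectorField
    (Y.mdiffAt x).mdifferentiableWithinAt (s := univ)
  rw [preimage_univ, ModelWithCorners.range_eq_univ, inter_univ,
    mpullbackWithin_univ] at h
  exact differentiableWithinAt_univ.1 h

/-- The bracket of vector fields acts on vector-valued functions as the commutator of the
derivations. -/
theorem mfderiv_lie_apply {f : M → G} (hf : ContMDiff 𝓘(ℝ, E) 𝓘(ℝ, G) ∞ f)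
    (Y Z : SmoothVF E M) (x : M) {fY fZ : M → G}
    (hY : ∀ y, mfderiv 𝓘(ℝ, E) 𝓘(ℝ, G) f y (Y y) = fY y)
    (hZ : ∀ y, mfderiv 𝓘(ℝ, E) 𝓘(ℝ, G) f y (Z y) = fZ y)
    (dY : MDifferentiableAt 𝓘(ℝ, E) 𝓘(ℝ, G) fY x)
    (dZ : MDifferentiableAt 𝓘(ℝ, E) 𝓘(ℝ, G) fZ x) {u w : G}
    (hu : mfderiv 𝓘(ℝ, E) 𝓘(ℝ, G) fZ x (Y x) = u)
    (hw : mfderiv 𝓘(ℝ, E) 𝓘(ℝ, G) fY x (Z x) = w) :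
    mfderiv 𝓘(ℝ, E) 𝓘(ℝ, G) f x (⁅Y, Z⁆ x) = (u - w : G) := by
  set φ := extChartAt 𝓘(ℝ, E) x with hφ
  have hz : φ x ∈ φ.target := mem_extChartAt_target (I := 𝓘(ℝ, E)) x
  have hx : φ.symm (φ x) = x := extChartAt_to_inv x
  have hbr : ⁅Y, Z⁆ x = (mfderiv 𝓘(ℝ, E) 𝓘(ℝ, E) φ x).inverse
      (lieBracket ℝ (chartField x Y) (chartField x Z) (φ x) : E) := by
    rw [SmoothVF.lie_apply, ← mlieBracketWithin_univ, mlieBracketWithin_apply]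
    simp only [ModelWithCorners.range_eq_univ, preimage_univ, inter_univ,
      mpullbackWithin_univ]
    exact congrArg (fun u : E ↦ (mfderiv 𝓘(ℝ, E) 𝓘(ℝ, E) φ x).inverse u)
      (congrFun (lieBracketWithin_univ (V := chartField x Y) (W := chartField x Z)) (φ x))
  have hfd (y : M) : MDifferentiableAt 𝓘(ℝ, E) 𝓘(ℝ, G) f y := hf.mdifferentiable (by simp) y
  -- The equality is needed on a neighbourhood, since both sides are differentiated once more.
  have hev (W : SmoothVF E M) {fW : M → G}
      (hW : ∀ y, mfderiv 𝓘(ℝ, E) 𝓘(ℝ, G) f y (W y) = fW y) :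
      (fun z ↦ fderiv ℝ (f ∘ φ.symm) z (chartField x W z)) =ᶠ[𝓝 (φ x)] fW ∘ φ.symm := by
    filter_upwards [extChartAt_target_mem_nhds (I := 𝓘(ℝ, E)) x] with z hz'
    rw [fderiv_comp_extChartAt_symm_chartField x W hz' (hfd _)]
    exact hW _
  have hgd : ContDiffAt ℝ 2 (f ∘ φ.symm) (φ x) := by
    have h1 : ContMDiffAt 𝓘(ℝ, E) 𝓘(ℝ, E) ∞ φ.symm (φ x) := by
      have := contMDiffOn_extChartAt_symm (I := 𝓘(ℝ, E)) (n := ∞) x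
      exact this.contMDiffAt (extChartAt_target_mem_nhds (I := 𝓘(ℝ, E)) x)
    exact ((hf.contMDiffAt.comp _ h1).contDiffAt).of_le SmoothVF.two_le_infty
  rw [hbr]
  refine (mfderiv_comp_extChartAt_inverse x (hfd x) _).trans ?_
  -- The second-order terms cancel by symmetry of the second derivative, hence the $C^2$ fact `hgd`.
  refine (fderiv_apply_lieBracket hgd (by simp) (differentiableAt_chartField x Z)
    (differentiableAt_chartField x Y)).trans ?_
  have k1 := fderiv_comp_extChartAt_symm_chartField (h := fZ) x Y hz (by rwa [hx])
  have k2 := fderiv_comp_extChartAt_symm_chartField (h := fY) x Z hz (by rwa [hx])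
  rw [← hφ] at k1 k2
  rw [(hev Z hZ).fderiv_eq, (hev Y hY).fderiv_eq, k1, k2, hx]
  exact congrArg₂ _ hu hw

end LieBracketDerivation

/-! ### Local left inverses of immersions -/

section LocalRetraction

variable {E : Type*} [NormedAddCommGroup E] [NormedSpace ℝ E]
  {M : Type*} [TopologicalSpace M] [ChartedSpace E M]
  {F : Type*} [NormedAddCommGroup F] [NormedSpace ℝ F]
  {S : Type*} [TopologicalSpace S] [ChartedSpace F S]

/-- An immersion admits a smooth left inverse near each point of its domain. -/
theorem Manifold.IsImmersionAt.exists_local_retraction [IsManifold 𝓘(ℝ, E) ∞ M]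
    [IsManifold 𝓘(ℝ, F) ∞ S] {j : S → M} {s : S}
    (h : Manifold.IsImmersionAt 𝓘(ℝ, F) 𝓘(ℝ, E) ∞ j s) :
    ∃ (r : M → S) (U : Set M), IsOpen U ∧ j s ∈ U ∧ ContMDiffOn 𝓘(ℝ, E) 𝓘(ℝ, F) ∞ r U ∧
      ∀ᶠ s' in 𝓝 s, r (j s') = s' := by
  -- In adapted charts $j$ is $u\mapsto(u,0)$ up to `h.equiv`, so projecting to the first factor
  -- undoes it.
  set p : E → F := fun y ↦ (h.equiv.symm y).1
  have hp : ContDiff ℝ ∞ p := by fun_prop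
  have key (s' : S) (hs' : s' ∈ h.domChart.source) :
      p (h.codChart (j s')) = h.domChart s' := by
    have h1 : h.domChart s' ∈ (h.domChart.extend 𝓘(ℝ, F)).target := by
      simpa using h.domChart.map_source hs'
    have h2 := h.writtenInCharts h1
    simp only [Function.comp_apply, OpenPartialHomeomorph.extend_coe,
      OpenPartialHomeomorph.extend_coe_symm, modelWithCornersSelf_coe, id_eq,
      modelWithCornersSelf_coe_symm, h.domChart.left_inv hs'] at h2
    simp [p, h2]
  refine ⟨h.domChart.symm ∘ p ∘ h.codChart,
    h.codChart.source ∩ h.codChart ⁻¹' (p ⁻¹' h.domChart.target),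
    h.codChart.isOpen_inter_preimage (h.domChart.open_target.preimage hp.continuous),
    ⟨h.mem_codChart_source, ?_⟩, ?_, ?_⟩
  · rw [mem_preimage, mem_preimage, key s h.mem_domChart_source]
    exact h.domChart.map_source h.mem_domChart_source
  · have h1 := contMDiffOn_of_mem_maximalAtlas h.codChart_mem_maximalAtlas
    have h2 := contMDiffOn_symm_of_mem_maximalAtlas h.domChart_mem_maximalAtlas
    exact h2.comp (hp.contMDiff.comp_contMDiffOn (h1.mono inter_subset_left)) fun y hy ↦ hy.2
  · filter_upwards [h.domChart.open_source.mem_nhds h.mem_domChart_source] with s' hs'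
    simp only [Function.comp_apply, key s' hs', h.domChart.left_inv hs']

/-- Differentiating $r\circ j=\mathrm{id}$ near $s$ gives a left inverse of $dj_s$. -/
theorem Manifold.IsImmersionAt.mfderiv_injective [IsManifold 𝓘(ℝ, E) ∞ M]
    [IsManifold 𝓘(ℝ, F) ∞ S] {j : S → M} {s : S}
    (h : Manifold.IsImmersionAt 𝓘(ℝ, F) 𝓘(ℝ, E) ∞ j s) :
    Function.Injective (mfderiv 𝓘(ℝ, F) 𝓘(ℝ, E) j s) := by
  obtain ⟨r, U, hU, hjs, hr, hrj⟩ := h.exists_local_retraction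
  have hr' : MDifferentiableAt 𝓘(ℝ, E) 𝓘(ℝ, F) r (j s) :=
    (hr.contMDiffAt (hU.mem_nhds hjs)).mdifferentiableAt (by simp)
  have hj : MDifferentiableAt 𝓘(ℝ, F) 𝓘(ℝ, E) j s := h.contMDiffAt.mdifferentiableAt (by simp)
  have h1 : (mfderiv 𝓘(ℝ, E) 𝓘(ℝ, F) r (j s)).comp (mfderiv 𝓘(ℝ, F) 𝓘(ℝ, E) j s) =
      mfderiv 𝓘(ℝ, F) 𝓘(ℝ, F) (id : S → S) s := by
    rw [← mfderiv_comp s hr' hj]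
    exact Filter.EventuallyEq.mfderiv_eq hrj
  intro u v huv
  have h2 (w : TangentSpace 𝓘(ℝ, F) s) :
      mfderiv 𝓘(ℝ, E) 𝓘(ℝ, F) r (j s) (mfderiv 𝓘(ℝ, F) 𝓘(ℝ, E) j s w) =
        mfderiv 𝓘(ℝ, F) 𝓘(ℝ, F) (id : S → S) s w := congrArg (· w) h1
  have h3 := (h2 u).symm.trans ((congrArg _ huv).trans (h2 v))
  rwa [mfderiv_id] at h3

end LocalRetraction

/-! ### Local extension of functions along an immersion -/

section LocalExtension

variable {E : Type*} [NormedAddCommGroup E] [NormedSpace ℝ E] [FiniteDimensional ℝ E]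
  {F : Type*} [NormedAddCommGroup F] [NormedSpace ℝ F]
  {S : Type*} [TopologicalSpace S] [ChartedSpace F S] [IsManifold 𝓘(ℝ, F) ∞ S]

/-- The extension is $f\circ r$ for a local retraction $r$; as $r$ is controlled only on $U$, it is
cut off by a bump function. -/
theorem Manifold.IsImmersionAt.exists_local_extension {j : S → E} {s : S}
    (h : Manifold.IsImmersionAt 𝓘(ℝ, F) 𝓘(ℝ, E) ∞ j s) (f : SmoothFn F S) :
    ∃ g : SmoothFn E E, ∀ᶠ s' in 𝓝 s, f s' = g (j s') := by
  obtain ⟨r, U, hU, hjs, hr, hrj⟩ := h.exists_local_retraction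
  obtain ⟨R, hR, hRU⟩ := Metric.isOpen_iff.1 hU _ hjs
  -- The closed support has radius $R/2<R$, so it stays inside $U$.
  let β : ContDiffBump (j s) := ⟨R / 4, R / 2, by positivity, by linarith⟩
  have hβU : tsupport β ⊆ U := by
    rw [β.tsupport_eq]
    exact (Metric.closedBall_subset_ball (by change R / 2 < R; linarith)).trans hRU
  have hfr : ContMDiffOn 𝓘(ℝ, E) 𝓘(ℝ, ℝ) ∞ (f ∘ r) U := f.contMDiff.comp_contMDiffOn hr
  refine ⟨⟨fun y ↦ β y * f (r y), contMDiff_of_tsupport fun y hy ↦ ?_⟩, ?_⟩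
  · have hy' : y ∈ U := hβU (tsupport_mul_subset_left hy)
    exact (β.contDiff.contMDiff.contMDiffAt).mul (hfr.contMDiffAt (hU.mem_nhds hy'))
  · have h1 : ∀ᶠ s' in 𝓝 s, β (j s') = 1 :=
      h.continuousAt.eventually β.eventuallyEq_one
    filter_upwards [h1, hrj] with s' h1 h2
    change f s' = β (j s') * f (r (j s'))
    rw [h1, h2, one_mul]

end LocalExtension

/-! ### Restriction of tangent vector fields -/

section RestrictField

variable {E : Type*} [NormedAddCommGroup E] [NormedSpace ℝ E]
  {M : Type*} [TopologicalSpace M] [ChartedSpace E M] [IsManifold 𝓘(ℝ, E) ∞ M]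
  {F : Type*} [NormedAddCommGroup F] [NormedSpace ℝ F]
  {S : Type*} [TopologicalSpace S] [ChartedSpace F S] [IsManifold 𝓘(ℝ, F) ∞ S]

/-- A vector field tangent to an immersion restricts to a smooth vector field. -/
theorem SmoothVF.exists_isRestriction {j : S → M}
    (hj : Manifold.IsImmersion 𝓘(ℝ, F) 𝓘(ℝ, E) ∞ j) (Y : SmoothVF E M)
    (hY : ∀ s, ∃ u, mfderiv 𝓘(ℝ, F) 𝓘(ℝ, E) j s u = Y (j s)) :
    ∃ Z : SmoothVF F S, Y.IsRestriction j Z := by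
  -- The choice is only pointwise; smoothness follows from the local formula $Z=dr(Y\circ j)$ with
  -- $r$ a smooth retraction.
  choose Z hZ using hY
  refine ⟨⟨Z, fun s ↦ ?_⟩, hZ⟩
  have : IsManifold 𝓘(ℝ, E) 1 M := IsManifold.of_le (n := ∞) (by simp)
  have : IsManifold 𝓘(ℝ, F) 1 S := IsManifold.of_le (n := ∞) (by simp)
  obtain ⟨r, U, hU, hjs, hr, hrj⟩ := (hj.isImmersionAt s).exists_local_retraction
  have h1 := hr.contMDiffOn_tangentMapWithin (m := ∞) (by simp) hU.uniqueMDiffOn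
  have h2 : ContMDiff 𝓘(ℝ, F) (𝓘(ℝ, E).prod 𝓘(ℝ, E)) ∞
      (fun s' ↦ (⟨j s', Y (j s')⟩ : TangentBundle 𝓘(ℝ, E) M)) := Y.contMDiff.comp hj.contMDiff
  have hjU : j ⁻¹' U ∈ 𝓝 s := hj.contMDiff.continuous.continuousAt (hU.mem_nhds hjs)
  have h3 : ContMDiffAt 𝓘(ℝ, F) (𝓘(ℝ, F).prod 𝓘(ℝ, F)) ∞
      (fun s' ↦ tangentMapWithin 𝓘(ℝ, E) 𝓘(ℝ, F) r U ⟨j s', Y (j s')⟩) s :=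
    ContMDiffOn.contMDiffAt (s := j ⁻¹' U)
      (h1.comp h2.contMDiffOn fun s' hs' ↦ hs') hjU
  refine h3.congr_of_eventuallyEq ?_
  filter_upwards [hrj.eventually_nhds, hjU] with s' h4 h5
  have hr' : MDifferentiableAt 𝓘(ℝ, E) 𝓘(ℝ, F) r (j s') :=
    (hr.contMDiffAt (hU.mem_nhds h5)).mdifferentiableAt (by simp)
  have h6 : HasMFDerivAt 𝓘(ℝ, F) 𝓘(ℝ, F) (r ∘ j) s'
      ((mfderiv 𝓘(ℝ, E) 𝓘(ℝ, F) r (j s')).comp (mfderiv 𝓘(ℝ, F) 𝓘(ℝ, E) j s')) :=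
    hr'.hasMFDerivAt.comp s' (hj.contMDiff.mdifferentiable (by simp) s').hasMFDerivAt
  have h7 : HasMFDerivAt 𝓘(ℝ, F) 𝓘(ℝ, F) (r ∘ j) s'
      (ContinuousLinearMap.id ℝ (TangentSpace 𝓘(ℝ, F) s')) :=
    (hasMFDerivAt_id s').congr_of_eventuallyEq h4
  have h8 := hasMFDerivAt_unique h6 h7
  have h9 : mfderiv 𝓘(ℝ, E) 𝓘(ℝ, F) r (j s') (Y (j s')) = Z s' := by
    rw [← hZ s']
    exact congrArg (· (Z s')) h8
  have h10 : r (j s') = s' := h4.self_of_nhds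
  change (⟨s', Z s'⟩ : TangentBundle 𝓘(ℝ, F) S) =
    ⟨r (j s'), mfderivWithin 𝓘(ℝ, E) 𝓘(ℝ, F) r U (j s') (Y (j s'))⟩
  rw [mfderivWithin_of_isOpen hU h5, h9, h10]

end RestrictField

/-! ### Vessiot–Guldberg algebras and homomorphisms from a simple algebra -/

theorem PoissonStructure.isLieHamiltonSystem_of_isVessiotGuldberg
    {E : Type*} [NormedAddCommGroup E] [NormedSpace ℝ E] [CompleteSpace E]
    {M : Type*} [TopologicalSpace M] [ChartedSpace E M] [IsManifold 𝓘(ℝ, E) ∞ M]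
    {P : PoissonStructure E M} {X : ℝ → SmoothVF E M} {V : LieSubalgebra ℝ (SmoothVF E M)}
    (hV : IsVessiotGuldberg V X) (hP : ∀ Y ∈ V, P.IsHamiltonianField Y) :
    P.IsLieHamiltonSystem X := by
  have hle : minimalLieAlgebra X ≤ V :=
    LieSubalgebra.lieSpan_le.2 (range_subset_iff.2 hV.2)
  have : FiniteDimensional ℝ V.toSubmodule := hV.1
  exact ⟨Submodule.finiteDimensional_of_le (S₂ := V.toSubmodule) hle, fun Y hY ↦ hP Y (hle hY)⟩

/-- The kernel is an ideal, hence $0$ or everything. -/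
theorem LieHom.injective_of_isSimple {𝔤 L : Type*} [LieRing 𝔤] [LieAlgebra ℝ 𝔤]
    [LieAlgebra.IsSimple ℝ 𝔤] [LieRing L] [LieAlgebra ℝ L] (φ : 𝔤 →ₗ⁅ℝ⁆ L) (h : ∃ v, φ v ≠ 0) :
    Function.Injective φ := by
  rw [← LieHom.ker_eq_bot]
  refine (LieAlgebra.IsSimple.eq_bot_or_eq_top φ.ker).resolve_right fun htop ↦ ?_
  obtain ⟨v, hv⟩ := h
  exact hv (LieHom.mem_ker.1 (htop ▸ LieSubmodule.mem_top v))

theorem isVessiotGuldberg_range {𝔤 : Type*} [LieRing 𝔤] [LieAlgebra ℝ 𝔤]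
    [FiniteDimensional ℝ 𝔤]
    {E : Type*} [NormedAddCommGroup E] [NormedSpace ℝ E] [CompleteSpace E]
    {M : Type*} [TopologicalSpace M] [ChartedSpace E M] [IsManifold 𝓘(ℝ, E) ∞ M]
    (ρ : 𝔤 →ₗ⁅ℝ⁆ SmoothVF E M) (h : ℝ → 𝔤) :
    IsVessiotGuldberg ρ.range fun t ↦ ρ (h t) :=
  ⟨inferInstanceAs (FiniteDimensional ℝ (LinearMap.range (ρ : 𝔤 →ₗ[ℝ] SmoothVF E M))),
    fun t ↦ ⟨h t, rfl⟩⟩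

/-! ### The linear Hamiltonian fields on the dual -/

namespace LieDual

variable {𝔤 : Type*} [LieRing 𝔤] [LieAlgebra ℝ 𝔤]

theorem ext_pair {θ η : LieDual 𝔤} (h : ∀ w, pair θ w = pair η w) : θ = η :=
  (toDual 𝔤).injective (LinearMap.ext h)

theorem pair_add (θ : LieDual 𝔤) (v w : 𝔤) : pair θ (v + w) = pair θ v + pair θ w :=
  map_add (toDual 𝔤 θ) v w

theorem pair_sub (θ : LieDual 𝔤) (v w : 𝔤) : pair θ (v - w) = pair θ v - pair θ w :=
  map_sub (toDual 𝔤 θ) v w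

theorem pair_neg (θ : LieDual 𝔤) (v : 𝔤) : pair θ (-v) = -pair θ v :=
  map_neg (toDual 𝔤 θ) v

theorem pair_smul (θ : LieDual 𝔤) (c : ℝ) (v : 𝔤) : pair θ (c • v) = c * pair θ v :=
  map_smul (toDual 𝔤 θ) c v

theorem pair_sub_left (θ η : LieDual 𝔤) (v : 𝔤) : pair (θ - η) v = pair θ v - pair η v := rfl

theorem flowVec_add (v w : 𝔤) (θ : LieDual 𝔤) : flowVec (v + w) θ = flowVec v θ + flowVec w θ :=
  ext_pair fun u ↦ by
    change pair θ ⁅v + w, u⁆ = pair θ ⁅v, u⁆ + pair θ ⁅w, u⁆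
    rw [add_lie, pair_add]

theorem flowVec_smul (c : ℝ) (v : 𝔤) (θ : LieDual 𝔤) : flowVec (c • v) θ = c • flowVec v θ :=
  ext_pair fun u ↦ by
    change pair θ ⁅c • v, u⁆ = c * pair θ ⁅v, u⁆
    rw [smul_lie, pair_smul]

/-- `flowVec v` is the transpose of $\mathrm{ad}_v$, which reverses the order of composition. This
is the sign needed below: the bracket of linear fields $A,B$ is $BA-AB$. -/
theorem flowVec_lie (v w : 𝔤) (θ : LieDual 𝔤) :
    flowVec ⁅v, w⁆ θ = flowVec w (flowVec v θ) - flowVec v (flowVec w θ) :=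
  ext_pair fun u ↦ by
    rw [pair_sub_left]
    simp only [pair_flowVec]
    rw [← pair_sub, lie_lie]

variable [FiniteDimensional ℝ 𝔤]

/-- The linear vector field `flowVec v` as a continuous linear map. -/
def flowCLM (v : 𝔤) : LieDual 𝔤 →L[ℝ] LieDual 𝔤 :=
  LinearMap.toContinuousLinearMap
    { toFun := flowVec v
      map_add' := fun _ _ ↦ rfl
      map_smul' := fun _ _ ↦ rfl }

theorem kksField_apply (v : 𝔤) (θ : LieDual 𝔤) : kksField v θ = flowVec v θ := kksVec_eq v θ

theorem isHamiltonianFieldOf_kksField (v : 𝔤) :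
    (kks 𝔤).IsHamiltonianFieldOf (linFn v) (kksField v) := fun g θ ↦ by
  rw [kks_apply, pair_lie_diff, diff_linFn, SmoothVF.deriv, kksField_apply, mfderiv_eq_fderiv]
  rfl

/-- Linear functions already determine a tangent vector of $\mathfrak g^*$, so it suffices to test
on them. -/
theorem eq_flowVec_of_isHamiltonianFieldOf {f : SmoothFn (LieDual 𝔤) (LieDual 𝔤)}
    {Y : SmoothVF (LieDual 𝔤) (LieDual 𝔤)} (h : (kks 𝔤).IsHamiltonianFieldOf f Y)
    (θ : LieDual 𝔤) : Y θ = flowVec (diff f θ) θ :=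
  ext_pair (𝔤 := 𝔤) fun w ↦ by
    have h1 := h (linFn w) θ
    rw [SmoothVF.deriv, mfderiv_eq_fderiv, kks_apply, diff_linFn] at h1
    have h2 : fderiv ℝ (linFn w) θ = evalCLM w := (evalCLM w).fderiv
    rw [h2] at h1
    exact h1

/-- A Hamiltonian field at $\theta$ depends only on $df_\theta\in\mathfrak g$, and these values
already form a subspace, so taking the span adds nothing. -/
theorem mem_characteristicSpace_iff (θ η : LieDual 𝔤) :
    η ∈ (kks 𝔤).characteristicSpace θ ↔ ∃ v : 𝔤, flowVec v θ = η := by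
  constructor
  · intro h
    refine Submodule.span_induction (p := fun η _ ↦ ∃ v : 𝔤, flowVec v θ = η) ?_ ?_ ?_ ?_ h
    · rintro _ ⟨Y, ⟨f, hf⟩, rfl⟩
      exact ⟨diff f θ, (eq_flowVec_of_isHamiltonianFieldOf hf θ).symm⟩
    · exact ⟨0, ext_pair fun w ↦ by rw [pair_flowVec, zero_lie]; exact map_zero (toDual 𝔤 θ)⟩
    · rintro _ _ _ _ ⟨v, rfl⟩ ⟨w, rfl⟩
      exact ⟨v + w, flowVec_add v w θ⟩
    · rintro c _ _ ⟨v, rfl⟩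
      exact ⟨c • v, flowVec_smul c v θ⟩
  · rintro ⟨v, rfl⟩
    exact Submodule.subset_span ⟨kksField v, ⟨linFn v, isHamiltonianFieldOf_kksField v⟩,
      kksField_apply v θ⟩

/-! ### Brackets of restricted fields -/

section Related

variable {F : Type*} [NormedAddCommGroup F] [NormedSpace ℝ F] [CompleteSpace F]
  {S : Type*} [TopologicalSpace S] [ChartedSpace F S] [IsManifold 𝓘(ℝ, F) ∞ S]
  {j : S → LieDual 𝔤}

/-- Regard $j$ as a $\mathfrak g^*$-valued function. Its derivative along $Y$ is a fixed linear map
composed with $j$, so second derivatives are compositions of such maps and `flowVec_lie` identifies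
their commutator. -/
theorem isRestriction_lie (hj : ContMDiff 𝓘(ℝ, F) 𝓘(ℝ, LieDual 𝔤) ∞ j) {v w : 𝔤}
    {Y Z : SmoothVF F S} (hY : (kksField v).IsRestriction j Y)
    (hZ : (kksField w).IsRestriction j Z) : (kksField ⁅v, w⁆).IsRestriction j ⁅Y, Z⁆ := by
  intro s
  have hjs (s : S) : MDifferentiableAt 𝓘(ℝ, F) 𝓘(ℝ, LieDual 𝔤) j s :=
    hj.mdifferentiable (by simp) s
  have hc (u : 𝔤) : HasMFDerivAt 𝓘(ℝ, F) 𝓘(ℝ, LieDual 𝔤) (fun y ↦ flowVec u (j y)) s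
      ((flowCLM u).comp (mfderiv 𝓘(ℝ, F) 𝓘(ℝ, LieDual 𝔤) j s)) :=
    (flowCLM u).hasMFDerivAt.comp s (hjs s).hasMFDerivAt
  have hd (u x : 𝔤) {W : SmoothVF F S} (hW : (kksField x).IsRestriction j W) :
      mfderiv 𝓘(ℝ, F) 𝓘(ℝ, LieDual 𝔤) (fun y ↦ flowVec u (j y)) s (W s) =
        flowVec u (flowVec x (j s)) := by
    rw [(hc u).mfderiv]
    exact congrArg (flowVec u) ((hW s).trans (kksField_apply x (j s)))
  rw [kksField_apply, flowVec_lie]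
  exact mfderiv_lie_apply hj Y Z s (fun y ↦ (hY y).trans (kksField_apply v (j y)))
    (fun y ↦ (hZ y).trans (kksField_apply w (j y))) (hc v).mdifferentiableAt
    (hc w).mdifferentiableAt (hd w v hY) (hd v w hZ)

/-- A family of vector fields restricting the fields `X_v` to an immersed manifold is a
representation of `𝔤` by vector fields. -/
def restrictionHom (hj : ContMDiff 𝓘(ℝ, F) 𝓘(ℝ, LieDual 𝔤) ∞ j)
    (hinj : ∀ s, Function.Injective (mfderiv 𝓘(ℝ, F) 𝓘(ℝ, LieDual 𝔤) j s))
    (Z : 𝔤 → SmoothVF F S) (hZ : ∀ v, (kksField v).IsRestriction j (Z v)) :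
    𝔤 →ₗ⁅ℝ⁆ SmoothVF F S where
  toFun := Z
  map_add' v w := by
    ext s
    apply hinj s
    refine (hZ _ s).trans ?_
    refine Eq.trans ?_ (map_add (mfderiv 𝓘(ℝ, F) 𝓘(ℝ, LieDual 𝔤) j s) (Z v s) (Z w s)).symm
    rw [hZ v s, hZ w s, kksField_apply, kksField_apply, kksField_apply, flowVec_add]
    rfl
  map_smul' c v := by
    ext s
    apply hinj s
    refine (hZ _ s).trans ?_
    refine Eq.trans ?_ (map_smul (mfderiv 𝓘(ℝ, F) 𝓘(ℝ, LieDual 𝔤) j s) c (Z v s)).symm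
    rw [hZ v s, kksField_apply, kksField_apply, flowVec_smul]
    rfl
  map_lie' {v w} := by
    ext s
    exact hinj s ((hZ _ s).trans (isRestriction_lie hj (hZ v) (hZ w) s).symm)

end Related

variable (𝔤) in
/-- The Lie algebra homomorphism `v ↦ X_v`. -/
def kksHom : 𝔤 →ₗ⁅ℝ⁆ SmoothVF (LieDual 𝔤) (LieDual 𝔤) :=
  restrictionHom (j := id) contMDiff_id
    (fun s ↦ by rw [mfderiv_id]; exact Function.injective_id) kksField
    (fun v s ↦ by rw [mfderiv_id]; rfl)

/-- If every $X_v$ vanished, all $\theta$ would kill every $[v,w]$ and $\mathfrak g$ would be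
abelian. -/
theorem kksHom_injective [LieAlgebra.IsSimple ℝ 𝔤] : Function.Injective (kksHom 𝔤) := by
  refine LieHom.injective_of_isSimple _ ?_
  by_contra! h
  refine LieAlgebra.IsSimple.non_abelian ℝ (L := 𝔤) ⟨fun v w ↦ ?_⟩
  rw [← Module.forall_dual_apply_eq_zero_iff ℝ]
  intro θ
  have h1 : kksField v ((toDual 𝔤).symm θ) = 0 := congrArg (fun Y ↦ Y ((toDual 𝔤).symm θ)) (h v)
  rw [kksField_apply] at h1
  have h2 := congrArg (pair (𝔤 := 𝔤) · w) h1
  exact h2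

end LieDual

/-! ### Differentials on a leaf represented by elements of the Lie algebra -/

namespace LieDual

variable {𝔤 : Type*} [LieRing 𝔤] [LieAlgebra ℝ 𝔤] [FiniteDimensional ℝ 𝔤]
  {F : Type*} [NormedAddCommGroup F] [NormedSpace ℝ F]
  {S : Type*} [TopologicalSpace S] [ChartedSpace F S]

variable (F) in
/-- An immersed manifold whose tangent spaces consist of the values of the fields `X_v`. -/
structure IsFlowImmersion (j : S → LieDual 𝔤) : Prop where
  immersion : Manifold.IsImmersion 𝓘(ℝ, F) 𝓘(ℝ, LieDual 𝔤) ∞ j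
  exists_tangent : ∀ (s : S) (v : 𝔤), ∃ ξ, mfderiv 𝓘(ℝ, F) 𝓘(ℝ, LieDual 𝔤) j s ξ = flowVec v (j s)
  exists_generator : ∀ (s : S) (ξ : TangentSpace 𝓘(ℝ, F) s), ∃ v : 𝔤,
    mfderiv 𝓘(ℝ, F) 𝓘(ℝ, LieDual 𝔤) j s ξ = flowVec v (j s)

/-- The restricted Poisson structure and fields are built from just these local properties of a
leaf. -/
theorem _root_.PoissonStructure.IsSymplecticLeaf.isFlowImmersion {j : S → LieDual 𝔤}
    (hj : (kks 𝔤).IsSymplecticLeaf F j) : IsFlowImmersion F j where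
  immersion := hj.immersion
  exists_tangent s v := by
    have h := (mem_characteristicSpace_iff (j s) (flowVec v (j s))).2 ⟨v, rfl⟩
    rw [← hj.tangent s] at h
    exact h
  exists_generator s ξ := by
    have h : mfderiv 𝓘(ℝ, F) 𝓘(ℝ, LieDual 𝔤) j s ξ ∈ (kks 𝔤).characteristicSpace (j s) := by
      rw [← hj.tangent s]
      exact ⟨ξ, rfl⟩
    obtain ⟨v, hv⟩ := (mem_characteristicSpace_iff _ _).1 h
    exact ⟨v, hv.symm⟩

variable (F) in
/-- The element `v ∈ 𝔤` represents the differential of `f` at `s`: `df_s` is the restriction of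
the covector `v` along `j`. -/
def Represents (j : S → LieDual 𝔤) (f : S → ℝ) (s : S) (v : 𝔤) : Prop :=
  ∀ ξ : TangentSpace 𝓘(ℝ, F) s, mfderiv 𝓘(ℝ, F) 𝓘(ℝ, ℝ) f s ξ =
    pair (𝔤 := 𝔤) (mfderiv 𝓘(ℝ, F) 𝓘(ℝ, LieDual 𝔤) j s ξ) v

variable {j : S → LieDual 𝔤} {s : S}

section Represents

theorem Represents.add {f g : SmoothFn F S} {v w : 𝔤} (hf : Represents F j f s v)
    (hg : Represents F j g s w) : Represents F j (f + g : SmoothFn F S) s (v + w) := fun ξ ↦ by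
  have hfd := f.contMDiff.mdifferentiable (by simp) s
  have hgd := g.contMDiff.mdifferentiable (by simp) s
  exact (congrArg (· ξ) (mfderiv_add hfd hgd)).trans
    ((congrArg₂ (fun a b : ℝ ↦ a + b) (hf ξ) (hg ξ)).trans (pair_add _ v w).symm)

theorem Represents.smul {f : SmoothFn F S} {v : 𝔤} (c : ℝ) (hf : Represents F j f s v) :
    Represents F j (c • f : SmoothFn F S) s (c • v) := fun ξ ↦ by
  have hfd := f.contMDiff.mdifferentiable (by simp) s
  exact (congrArg (· ξ) (const_smul_mfderiv hfd c)).trans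
    ((congrArg (fun a : ℝ ↦ c * a) (hf ξ)).trans (pair_smul _ c v).symm)

theorem Represents.mul {f g : SmoothFn F S} {v w : 𝔤} (hf : Represents F j f s v)
    (hg : Represents F j g s w) :
    Represents F j (f * g : SmoothFn F S) s (f s • w + g s • v) := fun ξ ↦ by
  have hfd := (f.contMDiff.mdifferentiable (by simp) s).hasMFDerivAt
  have hgd := (g.contMDiff.mdifferentiable (by simp) s).hasMFDerivAt
  have h (η : LieDual 𝔤) :
      f s * pair η w + g s * pair η v = pair η (f s • w + g s • v) := by
    rw [pair_add, pair_smul, pair_smul]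
  exact (congrArg (· ξ) (hfd.mul hgd).mfderiv).trans
    ((congrArg₂ (fun a b : ℝ ↦ f s * b + g s * a) (hf ξ) (hg ξ)).trans (h _))

theorem represents_diff [IsManifold 𝓘(ℝ, F) ∞ S] (hj : IsFlowImmersion F j) {f : S → ℝ}
    {g : SmoothFn (LieDual 𝔤) (LieDual 𝔤)}
    (h : ∀ᶠ s' in 𝓝 s, f s' = g (j s')) : Represents F j f s (diff g (j s)) := fun ξ ↦ by
  have hjd := hj.immersion.contMDiff.mdifferentiable (by simp) s
  have h2 : HasMFDerivAt 𝓘(ℝ, F) 𝓘(ℝ, ℝ) (fun s' ↦ g (j s')) s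
      ((fderiv ℝ g (j s)).comp (mfderiv 𝓘(ℝ, F) 𝓘(ℝ, LieDual 𝔤) j s)) :=
    (differentiable_coe g (j s)).hasFDerivAt.hasMFDerivAt.comp s hjd.hasMFDerivAt
  rw [Filter.EventuallyEq.mfderiv_eq h, h2.mfderiv]
  exact (pair_bidual _ (fderiv ℝ g (j s))).symm

theorem exists_represents [IsManifold 𝓘(ℝ, F) ∞ S] (hj : IsFlowImmersion F j) (f : SmoothFn F S)
    (s : S) : ∃ v : 𝔤, Represents F j f s v := by
  obtain ⟨g, hg⟩ := (hj.immersion.isImmersionAt s).exists_local_extension f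
  exact ⟨_, represents_diff hj hg⟩

/-- Both representatives agree on the image of $dj_s$, which contains $X_w(j(s))$; pairing that
vector with $v$ gives $\langle j(s),[w,v]\rangle$. -/
theorem Represents.pair_lie_eq_left (hj : IsFlowImmersion F j) {f : S → ℝ} {v v' : 𝔤}
    (hv : Represents F j f s v) (hv' : Represents F j f s v') (w : 𝔤) :
    pair (j s) ⁅w, v⁆ = pair (j s) ⁅w, v'⁆ := by
  obtain ⟨ξ, hξ⟩ := hj.exists_tangent s w
  have h := (hv ξ).symm.trans (hv' ξ)
  rw [hξ] at h
  exact h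

theorem Represents.pair_lie_eq (hj : IsFlowImmersion F j) {f g : S → ℝ} {v v' w w' : 𝔤}
    (hv : Represents F j f s v) (hv' : Represents F j f s v')
    (hw : Represents F j g s w) (hw' : Represents F j g s w') :
    pair (j s) ⁅v, w⁆ = pair (j s) ⁅v', w'⁆ := by
  rw [hw.pair_lie_eq_left hj hw' v, ← lie_skew, pair_neg, hv.pair_lie_eq_left hj hv' w',
    ← pair_neg, lie_skew]

end Represents

/-! ### The induced symplectic Poisson structure -/

section LeafPoisson

variable [IsManifold 𝓘(ℝ, F) ∞ S]

/-- An element of `𝔤` representing the differential of `f` at `s`. -/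
def leafDiff (hj : IsFlowImmersion F j) (f : SmoothFn F S) (s : S) : 𝔤 :=
  (exists_represents hj f s).choose

theorem represents_leafDiff (hj : IsFlowImmersion F j) (f : SmoothFn F S) (s : S) :
    Represents F j f s (leafDiff hj f s) := (exists_represents hj f s).choose_spec

theorem pair_leafDiff (hj : IsFlowImmersion F j) {f g : SmoothFn F S} {v w : 𝔤}
    (hf : Represents F j f s v) (hg : Represents F j g s w) :
    pair (j s) ⁅leafDiff hj f s, leafDiff hj g s⁆ = pair (j s) ⁅v, w⁆ :=
  (represents_leafDiff hj f s).pair_lie_eq hj hf (represents_leafDiff hj g s) hg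

/-- The representatives are chosen point by point with no continuity, yet the bracket is locally the
pullback of an ambient one. This supplies both smoothness and the Jacobi identity. -/
theorem eventually_pair_leafDiff (hj : IsFlowImmersion F j) {f g : SmoothFn F S}
    {f₀ g₀ : SmoothFn (LieDual 𝔤) (LieDual 𝔤)} (hf : ∀ᶠ s' in 𝓝 s, f s' = f₀ (j s'))
    (hg : ∀ᶠ s' in 𝓝 s, g s' = g₀ (j s')) :
    ∀ᶠ s' in 𝓝 s, pair (j s') ⁅leafDiff hj f s', leafDiff hj g s'⁆ =
      (kks 𝔤).bracket f₀ g₀ (j s') := by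
  filter_upwards [hf.eventually_nhds, hg.eventually_nhds] with s' hf' hg'
  rw [pair_leafDiff hj (represents_diff hj hf') (represents_diff hj hg'), kks_apply]

/-- The bracket of functions on an immersed manifold tangent to the fields `X_v`. -/
def leafBracketFn (hj : IsFlowImmersion F j) (f g : SmoothFn F S) : SmoothFn F S :=
  ⟨fun s ↦ pair (j s) ⁅leafDiff hj f s, leafDiff hj g s⁆, fun s ↦ by
    obtain ⟨f₀, hf⟩ := (hj.immersion.isImmersionAt s).exists_local_extension f
    obtain ⟨g₀, hg⟩ := (hj.immersion.isImmersionAt s).exists_local_extension g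
    exact (((kks 𝔤).bracket f₀ g₀).contMDiff.comp hj.immersion.contMDiff s).congr_of_eventuallyEq
      (eventually_pair_leafDiff hj hf hg)⟩

theorem leafBracketFn_apply (hj : IsFlowImmersion F j) {f g : SmoothFn F S} {v w : 𝔤}
    (hf : Represents F j f s v) (hg : Represents F j g s w) :
    leafBracketFn hj f g s = pair (j s) ⁅v, w⁆ := pair_leafDiff hj hf hg

theorem leafBracketFn_skew (hj : IsFlowImmersion F j) (f g : SmoothFn F S) :
    leafBracketFn hj f g = -leafBracketFn hj g f := by
  ext s
  change pair _ _ = -pair _ _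
  rw [← pair_neg, lie_skew]

theorem leafBracketFn_add (hj : IsFlowImmersion F j) (f g h : SmoothFn F S) :
    leafBracketFn hj f (g + h) = leafBracketFn hj f g + leafBracketFn hj f h := by
  ext s
  have hf := represents_leafDiff hj f s
  have hg := represents_leafDiff hj g s
  have hh := represents_leafDiff hj h s
  rw [ContMDiffMap.coe_add, Pi.add_apply, leafBracketFn_apply hj hf (hg.add hh),
    leafBracketFn_apply hj hf hg, leafBracketFn_apply hj hf hh, lie_add, pair_add]

theorem leafBracketFn_smul (hj : IsFlowImmersion F j) (c : ℝ) (f g : SmoothFn F S) :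
    leafBracketFn hj f (c • g) = c • leafBracketFn hj f g := by
  ext s
  have hf := represents_leafDiff hj f s
  have hg := represents_leafDiff hj g s
  rw [ContMDiffMap.coe_smul, Pi.smul_apply, leafBracketFn_apply hj hf (hg.smul c),
    leafBracketFn_apply hj hf hg, lie_smul, pair_smul, smul_eq_mul]

/-- The restriction of the Kirillov–Kostant–Souriau structure to an immersed manifold whose
tangent spaces consist of the values of the fields `X_v`. -/
def leafPoisson (hj : IsFlowImmersion F j) : PoissonStructure F S where
  bracket := LinearMap.mk₂ ℝ (leafBracketFn hj)
    (fun f f' g ↦ by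
      -- Antisymmetry transfers additivity from the second argument to the first.
      rw [leafBracketFn_skew, leafBracketFn_add, neg_add, ← leafBracketFn_skew,
        ← leafBracketFn_skew])
    (fun c f g ↦ by
      rw [leafBracketFn_skew, leafBracketFn_smul, ← smul_neg, ← leafBracketFn_skew])
    (leafBracketFn_add hj)
    (fun c f g ↦ leafBracketFn_smul hj c f g)
  skew := leafBracketFn_skew hj
  leibniz f g h := by
    ext s
    have hf := represents_leafDiff hj f s
    have hg := represents_leafDiff hj g s
    have hh := represents_leafDiff hj h s
    change leafBracketFn hj f (g * h) s =
      leafBracketFn hj f g s * h s + g s * leafBracketFn hj f h s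
    rw [leafBracketFn_apply hj hf (hg.mul hh), leafBracketFn_apply hj hf hg,
      leafBracketFn_apply hj hf hh, lie_add, lie_smul, lie_smul, pair_add, pair_smul, pair_smul]
    ring
  jacobi f g h := by
    ext s
    obtain ⟨f₀, hf⟩ := (hj.immersion.isImmersionAt s).exists_local_extension f
    obtain ⟨g₀, hg⟩ := (hj.immersion.isImmersionAt s).exists_local_extension g
    obtain ⟨h₀, hh⟩ := (hj.immersion.isImmersionAt s).exists_local_extension h
    -- The ambient bracket of $b_0,c_0$ extends the inner leaf bracket near $s$, so the comparison
    -- can be iterated.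
    have key {a b c : SmoothFn F S} {a₀ b₀ c₀ : SmoothFn (LieDual 𝔤) (LieDual 𝔤)}
        (ha : ∀ᶠ s' in 𝓝 s, a s' = a₀ (j s')) (hb : ∀ᶠ s' in 𝓝 s, b s' = b₀ (j s'))
        (hc : ∀ᶠ s' in 𝓝 s, c s' = c₀ (j s')) :
        leafBracketFn hj a (leafBracketFn hj b c) s =
          (kks 𝔤).bracket a₀ ((kks 𝔤).bracket b₀ c₀) (j s) :=
      (eventually_pair_leafDiff hj (g := leafBracketFn hj b c) ha
        (eventually_pair_leafDiff hj hb hc)).self_of_nhds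
    change leafBracketFn hj f (leafBracketFn hj g h) s + leafBracketFn hj g (leafBracketFn hj h f) s
      + leafBracketFn hj h (leafBracketFn hj f g) s = 0
    rw [key hf hg hh, key hg hh hf, key hh hf hg]
    exact congrArg (fun k : SmoothFn (LieDual 𝔤) (LieDual 𝔤) ↦ k (j s))
      ((kks 𝔤).jacobi f₀ g₀ h₀)

theorem leafPoisson_bracket_apply (hj : IsFlowImmersion F j) {f g : SmoothFn F S} {v w : 𝔤}
    (hf : Represents F j f s v) (hg : Represents F j g s w) :
    (leafPoisson hj).bracket f g s = pair (j s) ⁅v, w⁆ := leafBracketFn_apply hj hf hg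

theorem isRestriction_leafPoisson (hj : IsFlowImmersion F j) :
    (kks 𝔤).IsRestriction j (leafPoisson hj) := fun f g f' g' hf hg s ↦ by
  rw [leafPoisson_bracket_apply hj (represents_diff hj (.of_forall hf))
    (represents_diff hj (.of_forall hg)), kks_apply]

/-- The restriction of the linear function given by `v ∈ 𝔤`. -/
def leafLinFn (hj : IsFlowImmersion F j) (v : 𝔤) : SmoothFn F S :=
  ⟨fun s ↦ linFn v (j s), (linFn v).contMDiff.comp hj.immersion.contMDiff⟩

theorem represents_leafLinFn (hj : IsFlowImmersion F j) (v : 𝔤) (s : S) :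
    Represents F j (leafLinFn hj v) s v := by
  have h := represents_diff (s := s) hj (f := leafLinFn hj v) (g := linFn v)
    (.of_forall fun _ ↦ rfl)
  rwa [diff_linFn] at h

/-- Every tangent vector is the value of some $X_w$, and $df$ on it equals $-\{f,w|_S\}$. -/
theorem isSymplectic_leafPoisson (hj : IsFlowImmersion F j) : (leafPoisson hj).IsSymplectic := by
  intro s f hf
  obtain ⟨v, hv⟩ := exists_represents hj f s
  ext ξ
  obtain ⟨w, hw⟩ := hj.exists_generator s ξ
  have h := hf (leafLinFn hj w)
  rw [leafPoisson_bracket_apply hj hv (represents_leafLinFn hj w s)] at h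
  refine (hv ξ).trans ?_
  rw [hw, pair_flowVec, ← lie_skew, pair_neg, h, neg_zero]
  rfl

theorem isHamiltonianFieldOf_leafLinFn (hj : IsFlowImmersion F j) {v : 𝔤} {Z : SmoothVF F S}
    (hZ : (kksField v).IsRestriction j Z) :
    (leafPoisson hj).IsHamiltonianFieldOf (leafLinFn hj v) Z := fun g s ↦ by
  obtain ⟨w, hw⟩ := exists_represents hj g s
  rw [leafPoisson_bracket_apply hj (represents_leafLinFn hj v s) hw]
  refine (hw (Z s)).trans ?_
  rw [hZ s, kksField_apply]
  rfl

variable [CompleteSpace F]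

theorem exists_leafHom (hj : IsFlowImmersion F j) :
    ∃ ρ : 𝔤 →ₗ⁅ℝ⁆ SmoothVF F S, ∀ v, (kksField v).IsRestriction j (ρ v) := by
  have h (v : 𝔤) : ∃ Z : SmoothVF F S, (kksField v).IsRestriction j Z :=
    (kksField v).exists_isRestriction hj.immersion fun s ↦ by
      rw [kksField_apply]
      exact hj.exists_tangent s v
  choose Z hZ using h
  exact ⟨restrictionHom hj.immersion.contMDiff
    (fun s ↦ (hj.immersion.isImmersionAt s).mfderiv_injective) Z hZ, hZ⟩

/-- A nonzero tangent vector is the value of some $X_v$, so the homomorphism is not zero. -/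
theorem leafHom_injective [LieAlgebra.IsSimple ℝ 𝔤] [Nonempty S] [Nontrivial F]
    (hj : IsFlowImmersion F j) {ρ : 𝔤 →ₗ⁅ℝ⁆ SmoothVF F S}
    (hρ : ∀ v, (kksField v).IsRestriction j (ρ v)) : Function.Injective ρ := by
  refine LieHom.injective_of_isSimple _ ?_
  by_contra! h
  obtain ⟨s⟩ := ‹Nonempty S›
  obtain ⟨ξ, hξ⟩ := exists_ne (0 : F)
  obtain ⟨v, hv⟩ := hj.exists_generator s ξ
  refine hξ ((hj.immersion.isImmersionAt s).mfderiv_injective (hv.trans ?_))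
  rw [← kksField_apply, ← hρ v s, h v]
  rfl

end LeafPoisson

end LieDual

end

/-! ### The main theorem -/

theorem theorem1 {𝔤 : Type*} [LieRing 𝔤] [LieAlgebra ℝ 𝔤] [FiniteDimensional ℝ 𝔤]
    [LieAlgebra.IsSimple ℝ 𝔤] {ι : Type*} [Fintype ι] (e : Module.Basis ι ℝ 𝔤)
    (b : ι → ℝ → ℝ) :
    -- the system on `𝔤*` is a Lie–Hamilton system, with a VG Lie algebra isomorphic to `𝔤`
    ((kks 𝔤).IsLieHamiltonSystem (LieDual.kksSystem e b) ∧
      ∃ V₀ : LieSubalgebra ℝ (SmoothVF (LieDual 𝔤) (LieDual 𝔤)),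
        IsVessiotGuldberg V₀ (LieDual.kksSystem e b) ∧
        (∀ Y ∈ V₀, (kks 𝔤).IsHamiltonianField Y) ∧
        ∃ ρ : 𝔤 ≃ₗ⁅ℝ⁆ V₀, ∀ v : 𝔤, (ρ v : SmoothVF (LieDual 𝔤) (LieDual 𝔤)) =
          LieDual.kksField v) ∧
    -- restriction to the symplectic leaves of nonzero dimension
    ∀ (F : Type*) [NormedAddCommGroup F] [NormedSpace ℝ F] [FiniteDimensional ℝ F]
      [CompleteSpace F]
      (S : Type*) [TopologicalSpace S] [ChartedSpace F S] [IsManifold 𝓘(ℝ, F) ∞ S]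
      (j : S → LieDual 𝔤), (kks 𝔤).IsSymplecticLeaf F j → Module.finrank ℝ F ≠ 0 →
      ∃ (X : ℝ → SmoothVF F S) (P : PoissonStructure F S)
        (V : LieSubalgebra ℝ (SmoothVF F S)),
        (∀ t, (LieDual.kksSystem e b t).IsRestriction j (X t)) ∧
        (kks 𝔤).IsRestriction j P ∧ P.IsSymplectic ∧
        P.IsLieHamiltonSystem X ∧
        IsVessiotGuldberg V X ∧
        (∀ Y ∈ V, P.IsHamiltonianField Y) ∧
        ∃ ρ : 𝔤 ≃ₗ⁅ℝ⁆ V, ∀ v : 𝔤,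
          (LieDual.kksField v).IsRestriction j (ρ v : SmoothVF F S) := by
  refine ⟨?_, ?_⟩
  · have hV : IsVessiotGuldberg (LieDual.kksHom 𝔤).range (LieDual.kksSystem e b) :=
      isVessiotGuldberg_range (LieDual.kksHom 𝔤) fun t ↦ ∑ α, b α t • e α
    have hH : ∀ Y ∈ (LieDual.kksHom 𝔤).range, (kks 𝔤).IsHamiltonianField Y := by
      rintro _ ⟨v, rfl⟩
      exact ⟨_, LieDual.isHamiltonianFieldOf_kksField v⟩
    exact ⟨PoissonStructure.isLieHamiltonSystem_of_isVessiotGuldberg hV hH, _, hV, hH,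
      LieEquiv.ofInjective _ LieDual.kksHom_injective, fun v ↦ rfl⟩
  · intro F _ _ _ _ S _ _ _ j hleaf hF
    have hj := hleaf.isFlowImmersion
    have := hleaf.connected
    have : Nontrivial F := Module.nontrivial_of_finrank_pos (R := ℝ) (Nat.pos_of_ne_zero hF)
    obtain ⟨ρ, hρ⟩ := LieDual.exists_leafHom hj
    have hV := isVessiotGuldberg_range ρ fun t ↦ ∑ α, b α t • e α
    have hH : ∀ Y ∈ ρ.range, (LieDual.leafPoisson hj).IsHamiltonianField Y := by
      rintro _ ⟨v, rfl⟩
      exact ⟨_, LieDual.isHamiltonianFieldOf_leafLinFn hj (hρ v)⟩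
    -- The restricted system is $t\mapsto\rho(h(t))$, with $\rho$ applied to the same curve $h$ in
    -- $\mathfrak g$ as on $\mathfrak g^*$.
    exact ⟨_, LieDual.leafPoisson hj, ρ.range, fun t ↦ hρ _,
      LieDual.isRestriction_leafPoisson hj, LieDual.isSymplectic_leafPoisson hj,
      PoissonStructure.isLieHamiltonSystem_of_isVessiotGuldberg hV hH, hV, hH,
      LieEquiv.ofInjective _ (LieDual.leafHom_injective hj hρ), hρ⟩
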